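/- **Setting.** Fix $t_0\in\mathbb R$, integers $m,n,m_1,\dots,m_N\ge 0$ and $N\ge 1$ agents $i\in\mathcal N=\{1,\dots,N\}$ with identical internal dynamics, $$\dot y_i=F_i(t,y_i,z_i)+\Gamma_i(t,w_i)u_i,\qquad \dot z_i=Z(t,z_i,y_i),\qquad w_i=W_i(y_i,z_i),\qquad y_i\in\mathbb R^m,\ z_i\in\mathbb R^n,\ w_i\in\mathbb R^{m_i},$$ coupled by $$u_i=\Gamma_i(t,w_i)^{-1}\sum_{j\in\mathcal N_i}\Big(\mu_{ij}^p\big((y_j^p-y_i^p)/\psi_{ij}^p(t)\big)\Big)_{p=1}^m .$$ All norms are maximum norms (for matrices, the induced norm), and solutions are Carathéodory solutions. A solution of the coupled system evolves where the coupling is defined, i.e. where $|y_j^p-y_i^p|<\psi_{ij}^p(t)$ for all edges and all $p$; in particular its initial value lies there. Assume: 1. $F_i,Z,\Gamma_i$ are measurable in $t\ge t_0$, locally Lipschitz in the remaining variables, and bounded on compact sets of these uniformly in $t$; $W_i$ is locally Lipschitz. 2. $\Gamma_i(t,w)$ is invertible for all $t\ge t_0$ and $w$, and $\|\Gamma_i(t,w)^{-1}\|$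 is bounded uniformly in $i,t,w$. 3. The communication graph $\mathcal G$ (with $\mathcal N_i$ the neighbours of $i$) is undirected and connected, with diameter $d_{\mathcal G}$. 4. For every edge and every $p\in\{1,\dots,m\}$, $\psi_{ij}^p=\psi_{ji}^p:[t_0,\infty)\to\mathbb R_{>0}$ is bounded and $C^1$ with bounded derivative, and $\mu_{ij}^p:(-1,1)\to\mathbb R$ is continuous with $\mu_{ij}^p(s)\to\pm\infty$ as $s\to\pm1$ and $\mu_{ij}^p(-s)=-\mu_{ji}^p(s)$. Put $\Psi(t)=\max_{p}\max_{(j,i)}\psi_{ij}^p(t)$, the inner maximum running over the edges (with $\Psi=0$ if there is nothing to maximize over). 5. For every $\tau\ge t_0$ and all locally absolutely continuous $e_i:[\tau,\infty)\to\mathbb R^m$ with $\|e_i(t)\|\le d_{\mathcal G}\Psi(t)$, the system $\dot s=\frac1N\sum_iF_i(t,s+e_i,z_i)$, $\dot z_i=Z(t,z_i,s+e_i)$ has a solution on $[\tau,\infty)$ for all initial values at $\tau$. A system $\dot x=f(t,x,u)$ is *$\delta$-ISS with $(\beta,\hat\gamma)$*, where $\beta\in\mathcal{KL}$ and $\hat\gamma\in\mathcal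 K_\infty$, if for every initial time $\tau\ge t_0$ it has a solution on $[\tau,\infty)$ for every initial value and every measurable, locally essentially bounded input, and if any two solutions $x,x'$ on $[\tau,\infty)$ with such inputs $u,u'$ satisfy $$\|x(t)-x'(t)\|\le\beta(\|x(\tau)-x'(\tau)\|,t-\tau)+\hat\gamma\Big(\sup_{s\in[\tau,t)}\|u(s)-u'(s)\|\Big)\quad\text{for all } t\ge\tau .$$ (A supremum over the empty set is $0$.) **Hypotheses.** The internal dynamics $\dot z=Z(t,z,s)$ with input $s$ are $\delta$-ISS with $(\tilde\beta,\bar\gamma)$, and the perturbed reduced-order blended dynamics $$\dot s=\tfrac1N\sum_iF_i(t,s+e_i,z+d_i),\qquad \dot z=Z(t,z,s+e_0)$$ with input $(e_0,e_1,\dots,e_N,d_1,\dots,d_N)$ are $\delta$-ISS with $(\beta,\hat\gamma)$. **Claim.** Let $M>0$ and let $\tilde w:[0,\infty)\to(0,1]$ be decreasing with limit $0$. For $\tilde\gamma\in\mathcal K_\infty$ and a solution of the coupled system let $$D(t)=\max_{i,j}\tilde\beta(\|z_j(t_0)-z_i(t_0)\|,t-t_0)+\tilde\gamma\Big(\sup_{s\in[t_0,t)}d_{\mathcal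 G}\Psi(s)\tilde w(t-s)\Big).$$ (a) There is $\tilde\gamma\in\mathcal K_\infty$ such that $\|z_j(t)-z_i(t)\|\le D(t)$ for all $i,j$, along every solution of the coupled system with $\max_{i,j}\|z_j(t_0)-z_i(t_0)\|\le M$. (b) For every $\tilde\gamma$ as in (a) and every decreasing $w:[0,\infty)\to(0,1]$ with limit $0$ there is $\gamma\in\mathcal K_\infty$ such that for every solution of the coupled system with $\max_{i,j}\|z_j(t_0)-z_i(t_0)\|\le M$, for every $i\in\mathcal N$, and for every solution $(\tilde s,\tilde z)$ of the reduced-order blended dynamics $$\dot{\tilde s}=\tfrac1N\sum_iF_i(t,\tilde s,\tilde z),\quad \dot{\tilde z}=Z(t,\tilde z,\tilde s),\qquad \tilde s(t_0)=\tfrac1N\sum_iy_i(t_0),\quad \tilde z(t_0)=\tfrac1N\sum_iz_i(t_0),$$ one has $$\left\|\begin{bmatrix}y_i(t)\\z_i(t)\end{bmatrix}-\begin{bmatrix}\tilde s(t)\\\tilde z(t)\end{bmatrix}\right\|\le\beta(\|z_i(t_0)-\tilde z(t_0)\|,t-t_0)+\gamma\Big(\sup_{s\in[t_0,t)}\max\{d_{\mathcal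 G}\Psi(s),D(s)\}\,w(t-s)\Big)+d_{\mathcal G}\Psi(t).$$ Both estimates hold for all $t\ge t_0$ in the interval $[t_0,\omega)$, $\omega\le\infty$, on which the solution of the coupled system is considered; this includes maximal and global solutions. -/

import Mathlib

open Set Filter Topology MeasureTheory
open scoped Matrix

noncomputable section

/-! Vectors are functions on `Fin m` and stacked vectors are pairs or families of those, so that
`‖·‖` is the maximum norm throughout. -/

/-! ### Comparison functions -/

/-- Class `K∞`: continuous, strictly increasing, zero at zero and unbounded on `[0, ∞)`. -/
structure ClassKInf (α : ℝ → ℝ) : Prop where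
  continuousOn : ContinuousOn α (Ici 0)
  strictMonoOn : StrictMonoOn α (Ici 0)
  map_zero : α 0 = 0
  tendsto_atTop : Tendsto α atTop atTop

/-- Class `KL`: `β(·, t)` is continuous, strictly increasing and zero at zero for every `t ≥ 0`, and
`β(r, ·)` is decreasing with limit zero for every `r ≥ 0`. -/
structure ClassKL (β : ℝ → ℝ → ℝ) : Prop where
  continuousOn : ∀ t, 0 ≤ t → ContinuousOn (fun r => β r t) (Ici 0)
  strictMonoOn : ∀ t, 0 ≤ t → StrictMonoOn (fun r => β r t) (Ici 0)
  map_zero : ∀ t, 0 ≤ t → β 0 t = 0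
  antitoneOn : ∀ r, 0 ≤ r → AntitoneOn (β r) (Ici 0)
  tendsto_zero : ∀ r, 0 ≤ r → Tendsto (β r) atTop (𝓝 0)

/-- Decreasing functions `w : [0, ∞) → (0, 1]` with limit zero. -/
structure IsDecayWeight (w : ℝ → ℝ) : Prop where
  pos : ∀ t, 0 ≤ t → 0 < w t
  le_one : ∀ t, 0 ≤ t → w t ≤ 1
  antitoneOn : AntitoneOn w (Ici 0)
  tendsto_zero : Tendsto w atTop (𝓝 0)

/-! ### Differential equations, inputs and incremental input-to-state stability -/

/-- `x` is a Carathéodory solution of `ẋ(t) = f(t, x(t))` on the interval `[τ, ω)`, where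
`ω ≤ ∞`; the differential equation is written in its integrated form. -/
def IsCaratheodorySol {X : Type*} [NormedAddCommGroup X] [NormedSpace ℝ X]
    (f : ℝ → X → X) (τ : ℝ) (ω : EReal) (x : ℝ → X) : Prop :=
  ∀ t : ℝ, τ ≤ t → (t : EReal) < ω →
    IntervalIntegrable (fun s => f s (x s)) volume τ t ∧
      x t = x τ + ∫ s in τ..t, f s (x s)

/-- (Lebesgue) measurable, locally essentially bounded inputs on `[τ, ∞)`. -/
structure IsInput {U : Type*} [NormedAddCommGroup U] (τ : ℝ) (u : ℝ → U) : Prop where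
  aestronglyMeasurable : AEStronglyMeasurable u (volume.restrict (Ici τ))
  locallyEssBounded : ∀ T, τ ≤ T → ∃ C : ℝ, ∀ᵐ s ∂(volume.restrict (Icc τ T)), ‖u s‖ ≤ C

/-- The system `ẋ(t) = f(t, x(t), u(t))` on `[t₀, ∞)` is `δ`-ISS with `(β, γ)`: its solutions exist
globally, and they satisfy the incremental estimate, from every initial time `τ ≥ t₀`.  Where the
input difference is unbounded on `[τ, t)` the estimate says nothing (its supremum is `∞`). -/
structure DeltaISS {X U : Type*} [NormedAddCommGroup X] [NormedSpace ℝ X] [NormedAddCommGroup U]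
    (t₀ : ℝ) (f : ℝ → X → U → X) (β : ℝ → ℝ → ℝ) (γ : ℝ → ℝ) : Prop where
  classKL : ClassKL β
  classKInf : ClassKInf γ
  exists_sol : ∀ τ, t₀ ≤ τ → ∀ u : ℝ → U, IsInput τ u → ∀ x₀ : X,
    ∃ x : ℝ → X, x τ = x₀ ∧ IsCaratheodorySol (fun t x => f t x (u t)) τ ⊤ x
  estimate : ∀ τ, t₀ ≤ τ → ∀ u u' : ℝ → U, IsInput τ u → IsInput τ u' → ∀ x x' : ℝ → X,
    IsCaratheodorySol (fun t x => f t x (u t)) τ ⊤ x →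
    IsCaratheodorySol (fun t x => f t x (u' t)) τ ⊤ x' →
    ∀ t, τ ≤ t → BddAbove ((fun s => ‖u s - u' s‖) '' Ico τ t) →
      ‖x t - x' t‖ ≤
        β ‖x τ - x' τ‖ (t - τ) + γ (sSup ((fun s => ‖u s - u' s‖) '' Ico τ t))

/-! ### The multi-agent system -/

/-- The data of `N` agents with outputs in `ℝᵐ`, internal states in `ℝⁿ`, a common vector field `Z`
of the internal dynamics, and an edge-wise coupling over an undirected graph.  Agent `i` receives
from the agents adjacent to it; `μ i j p` and `ψ i j p` belong to the edge from `j` to `i`. -/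
structure AgentNetwork (N m n : ℕ) where
  t₀ : ℝ
  F : Fin N → ℝ → (Fin m → ℝ) → (Fin n → ℝ) → (Fin m → ℝ)
  Z : ℝ → (Fin n → ℝ) → (Fin m → ℝ) → (Fin n → ℝ)
  /-- dimensions of the introspective outputs -/
  k : Fin N → ℕ
  W : (i : Fin N) → (Fin m → ℝ) → (Fin n → ℝ) → (Fin (k i) → ℝ)
  Γ : (i : Fin N) → ℝ → (Fin (k i) → ℝ) → Matrix (Fin m) (Fin m) ℝ
  G : SimpleGraph (Fin N)
  ψ : Fin N → Fin N → Fin m → ℝ → ℝ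
  μ : Fin N → Fin N → Fin m → ℝ → ℝ

/-- Measurable in `t`, locally Lipschitz in the state, and bounded on every compact set of states
uniformly in `t ≥ t₀`. -/
structure IsRegularField {X Y : Type*} [NormedAddCommGroup X] [NormedAddCommGroup Y]
    (t₀ : ℝ) (f : ℝ → X → Y) : Prop where
  measurable : ∀ x, AEStronglyMeasurable (fun t => f t x) (volume.restrict (Ici t₀))
  locallyLipschitz : ∀ t, t₀ ≤ t → LocallyLipschitz (f t)
  bounded : ∀ K : Set X, IsCompact K → ∃ C : ℝ, ∀ t, t₀ ≤ t → ∀ x ∈ K, ‖f t x‖ ≤ C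

namespace AgentNetwork

variable {N m n : ℕ} (S : AgentNetwork N m n)

/-- Assumption on the open loop dynamics. -/
structure OpenLoop : Prop where
  F : ∀ i, IsRegularField S.t₀ (fun t (x : (Fin m → ℝ) × (Fin n → ℝ)) => S.F i t x.1 x.2)
  Z : IsRegularField S.t₀ (fun t (x : (Fin n → ℝ) × (Fin m → ℝ)) => S.Z t x.1 x.2)
  Γ : ∀ i, IsRegularField S.t₀
    (fun t (w : Fin (S.k i) → ℝ) => (fun a b => S.Γ i t w a b : Fin m → Fin m → ℝ))
  W : ∀ i, LocallyLipschitz (fun x : (Fin m → ℝ) × (Fin n → ℝ) => S.W i x.1 x.2)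

section
open scoped Matrix.Norms.Operator

/-- Assumption on the gain matrices; `‖·‖` is the matrix norm induced by the maximum norm. -/
structure GainMatrix : Prop where
  isUnit : ∀ i t, S.t₀ ≤ t → ∀ w, IsUnit (S.Γ i t w)
  inv_bounded : ∃ M : ℝ, 0 < M ∧ ∀ i t, S.t₀ ≤ t → ∀ w, ‖(S.Γ i t w)⁻¹‖ ≤ M

end

/-- Assumption on the performance functions `ψ` and the coupling functions `μ`. -/
structure DesignFunctions : Prop where
  ψ_pos : ∀ i j, S.G.Adj i j → ∀ p t, S.t₀ ≤ t → 0 < S.ψ i j p t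
  ψ_bounded : ∀ i j, S.G.Adj i j → ∀ p, ∃ C : ℝ, ∀ t, S.t₀ ≤ t → S.ψ i j p t ≤ C
  ψ_contDiffOn : ∀ i j, S.G.Adj i j → ∀ p, ContDiffOn ℝ 1 (S.ψ i j p) (Ici S.t₀)
  ψ_deriv_bounded : ∀ i j, S.G.Adj i j → ∀ p, ∃ C : ℝ, ∀ t, S.t₀ ≤ t →
    |derivWithin (S.ψ i j p) (Ici S.t₀) t| ≤ C
  ψ_symm : ∀ i j, S.G.Adj i j → ∀ p t, S.t₀ ≤ t → S.ψ i j p t = S.ψ j i p t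
  μ_continuousOn : ∀ i j, S.G.Adj i j → ∀ p, ContinuousOn (S.μ i j p) (Ioo (-1) 1)
  μ_tendsto_one : ∀ i j, S.G.Adj i j → ∀ p, Tendsto (S.μ i j p) (𝓝[<] 1) atTop
  μ_tendsto_neg_one : ∀ i j, S.G.Adj i j → ∀ p, Tendsto (S.μ i j p) (𝓝[>] (-1)) atBot
  μ_symm : ∀ i j, S.G.Adj i j → ∀ p, ∀ s ∈ Ioo (-1 : ℝ) 1, S.μ i j p (-s) = -S.μ j i p s

/-- `Ψ(t)`, the largest value of a performance function over all edges and components. -/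
def Psi (t : ℝ) : ℝ :=
  ⨆ q : {q : Fin N × Fin N × Fin m // S.G.Adj q.1 q.2.1}, S.ψ q.1.1 q.1.2.1 q.1.2.2 t

/-- `d_G Ψ(t)`, with `d_G` the diameter of the graph. -/
def funnelRadius (t : ℝ) : ℝ := (S.G.diam : ℝ) * S.Psi t

/-- The vector field of the perturbed blended dynamics with inputs `e₁, …, e_N`. -/
def perturbedBlended (t : ℝ) (x : (Fin m → ℝ) × (Fin N → Fin n → ℝ)) (e : Fin N → Fin m → ℝ) :
    (Fin m → ℝ) × (Fin N → Fin n → ℝ) :=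
  ((1 / (N : ℝ)) • ∑ i, S.F i t (x.1 + e i) (x.2 i), fun i => S.Z t (x.2 i) (x.1 + e i))

/-- No finite escape time of the perturbed blended dynamics. -/
def NoFiniteEscape : Prop :=
  ∀ τ, S.t₀ ≤ τ → ∀ e : ℝ → Fin N → Fin m → ℝ,
    (∀ i T, τ ≤ T → AbsolutelyContinuousOnInterval (fun t => e t i) τ T) →
    (∀ i t, τ ≤ t → ‖e t i‖ ≤ S.funnelRadius t) →
    ∀ x₀ : (Fin m → ℝ) × (Fin N → Fin n → ℝ), ∃ x : ℝ → (Fin m → ℝ) × (Fin N → Fin n → ℝ),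
      x τ = x₀ ∧ IsCaratheodorySol (fun t x => S.perturbedBlended t x (e t)) τ ⊤ x

open Classical in
/-- The edge-wise funnel coupling law `uᵢ`, as a function of time and all outputs. -/
def coupling (i : Fin N) (t : ℝ) (w : Fin (S.k i) → ℝ) (y : Fin N → Fin m → ℝ) : Fin m → ℝ :=
  (S.Γ i t w)⁻¹ *ᵥ
    ∑ j with S.G.Adj i j, (fun p => S.μ i j p ((y j p - y i p) / S.ψ i j p t) : Fin m → ℝ)

/-- The vector field of the agents under the funnel coupling; the state consists of all outputs and
all internal states. -/
def closedLoop (t : ℝ) (x : (Fin N → Fin m → ℝ) × (Fin N → Fin n → ℝ)) :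
    (Fin N → Fin m → ℝ) × (Fin N → Fin n → ℝ) :=
  (fun i => S.F i t (x.1 i) (x.2 i) +
      S.Γ i t (S.W i (x.1 i) (x.2 i)) *ᵥ S.coupling i t (S.W i (x.1 i) (x.2 i)) x.1,
    fun i => S.Z t (x.2 i) (x.1 i))

/-- `(y, z)` solves the closed loop on `[t₀, ω)`, where `ω ≤ ∞`.  The coupling functions live on
`(-1, 1)`, so the closed loop is only defined where `|yⱼᵖ - yᵢᵖ| < ψᵢⱼᵖ(t)` on all edges, and a
solution evolves there; in particular its initial value lies there. -/
structure IsClosedLoopSol (ω : EReal) (y : ℝ → Fin N → Fin m → ℝ) (z : ℝ → Fin N → Fin n → ℝ) :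
    Prop where
  mem_domain : ∀ t : ℝ, S.t₀ ≤ t → (t : EReal) < ω → ∀ i j, S.G.Adj i j → ∀ p,
    |y t j p - y t i p| < S.ψ i j p t
  sol : IsCaratheodorySol S.closedLoop S.t₀ ω (fun t => (y t, z t))

/-- The vector field of the reduced order blended dynamics. -/
def reducedBlended (t : ℝ) (x : (Fin m → ℝ) × (Fin n → ℝ)) : (Fin m → ℝ) × (Fin n → ℝ) :=
  ((1 / (N : ℝ)) • ∑ i, S.F i t x.1 x.2, S.Z t x.2 x.1)

/-- The vector field of the perturbed reduced order blended dynamics with input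
`(e₀, (e₁, …, e_N), (d₁, …, d_N))`. -/
def perturbedReduced (t : ℝ) (x : (Fin m → ℝ) × (Fin n → ℝ))
    (u : (Fin m → ℝ) × (Fin N → Fin m → ℝ) × (Fin N → Fin n → ℝ)) :
    (Fin m → ℝ) × (Fin n → ℝ) :=
  ((1 / (N : ℝ)) • ∑ i, S.F i t (x.1 + u.2.1 i) (x.2 + u.2.2 i), S.Z t x.2 (x.1 + u.1))

/-- `D(t)` for the initial internal states `z₁(t₀), …, z_N(t₀)`. -/
def D (βt : ℝ → ℝ → ℝ) (γt wt : ℝ → ℝ) (z₀ : Fin N → Fin n → ℝ) (t : ℝ) : ℝ :=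
  (⨆ q : Fin N × Fin N, βt ‖z₀ q.2 - z₀ q.1‖ (t - S.t₀)) +
    γt (sSup ((fun s => S.funnelRadius s * wt (t - s)) '' Ico S.t₀ t))

/-- `D` bounds all differences of internal states, along every solution of the closed loop whose
initial internal states differ by at most `M`. -/
def DBoundsInternal (M : ℝ) (βt : ℝ → ℝ → ℝ) (γt wt : ℝ → ℝ) : Prop :=
  ∀ ω y z, S.IsClosedLoopSol ω y z → (∀ i j, ‖z S.t₀ j - z S.t₀ i‖ ≤ M) →
    ∀ t : ℝ, S.t₀ ≤ t → (t : EReal) < ω → ∀ i j,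
      ‖z t j - z t i‖ ≤ S.D βt γt wt (z S.t₀) t

end AgentNetwork

end

/-! A δ-ISS estimate restarted at `T - L` forgets the older past: if the difference of two solutions
at that time is at most a constant `K`, their difference at `T` is at most `β K L` plus the gain of
the inputs on `[T - L, T)`. There an input bound `ρ s` is at most `v / w L`, where `v` is the
supremum of `ρ s * w (T - s)`. The infimum over `L` of `β K L + γ (v / w L)` tends to zero with `v`,
since `L` may be fixed first, and so it lies below a class `K∞` function of `v`. This is
`DeltaISS.exists_fading_estimate`; both claims are instances of it.

For (a), the internal states of two agents solve the same system, driven by outputs that differ by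
at most `d_G Ψ`, because each edge of a shortest path contributes at most `Ψ`. For (b), the
antisymmetry of the coupling cancels it from the average output. Hence the average and `z i` solve
the perturbed reduced dynamics, with output deviations bounded by `d_G Ψ` and internal ones by `D`,
while the blended solution has input zero. Passing from the average to `y i` costs the final `d_G
Ψ(t)`. -/

/-! ### Comparison functions -/

/-- A monotone function vanishing continuously at zero has a class `K∞` majorant. -/
theorem exists_classKInf_ge {g : ℝ → ℝ} (hg : Monotone g) (h0 : g 0 = 0)
    (hc : ContinuousAt g 0) : ∃ γ : ℝ → ℝ, ClassKInf γ ∧ ∀ v, 0 ≤ v → g v ≤ γ v := by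
  have hint : ∀ v : ℝ, 0 ≤ v → IntervalIntegrable (fun s => g (v * s)) volume 1 2 := fun v hv =>
    (hg.comp (monotone_id.const_mul hv)).intervalIntegrable
  have hlow : ∀ v : ℝ, 0 ≤ v → g v ≤ ∫ s in (1 : ℝ)..2, g (v * s) := by
    intro v hv
    have h := intervalIntegral.integral_mono_on (μ := volume) (f := fun _ => g v)
      (by norm_num : (1 : ℝ) ≤ 2) (by simp) (hint v hv)
      (fun s hs => hg (by nlinarith [hs.1] : v ≤ v * s))
    have he : ∫ _ in (1 : ℝ)..2, g v = g v := by
      rw [intervalIntegral.integral_const]; norm_num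
    rwa [he] at h
  have hup : ∀ v : ℝ, 0 ≤ v → ∫ s in (1 : ℝ)..2, g (v * s) ≤ g (v * 2) := by
    intro v hv
    have h := intervalIntegral.integral_mono_on (μ := volume) (g := fun _ => g (v * 2))
      (by norm_num : (1 : ℝ) ≤ 2) (hint v hv) (by simp)
      (fun s hs => hg (by nlinarith [hs.2] : v * s ≤ v * 2))
    have he : ∫ _ in (1 : ℝ)..2, g (v * 2) = g (v * 2) := by
      rw [intervalIntegral.integral_const]; norm_num
    rwa [he] at h
  have hnonneg : ∀ v : ℝ, 0 ≤ v → 0 ≤ g v := fun v hv => h0 ▸ hg hv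
  have hmono : ∀ a b : ℝ, 0 ≤ a → a ≤ b →
      ∫ s in (1 : ℝ)..2, g (a * s) ≤ ∫ s in (1 : ℝ)..2, g (b * s) := fun a b ha hab =>
    intervalIntegral.integral_mono_on (by norm_num) (hint a ha) (hint b (ha.trans hab))
      (fun s hs => hg (by nlinarith [hs.1]))
  -- The integral is the mean of `g` over `[v, 2v]`, squeezed between `g v` and `g (2v)`. Averaging
  -- removes the jumps of `g`; the summand `v` gives strict growth and unboundedness.
  refine ⟨fun v => (∫ s in (1 : ℝ)..2, g (v * s)) + v, ⟨?_, ?_, ?_, ?_⟩, fun v hv => ?_⟩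
  · refine ContinuousOn.add (fun v hv => ?_) continuousOn_id
    rcases (mem_Ici.1 hv).eq_or_lt with rfl | hv
    · have hz : ∫ s in (1 : ℝ)..2, g (0 * s) = 0 := by simp [h0]
      have h2 : Tendsto (fun v : ℝ => g (v * 2)) (𝓝[Ici 0] 0) (𝓝 0) := by
        have h3 : Tendsto (fun v : ℝ => v * 2) (𝓝 0) (𝓝 0) := by
          simpa using (continuous_id.mul_const (2 : ℝ)).tendsto 0
        have h4 : Tendsto g (𝓝 0) (𝓝 0) := by simpa [ContinuousAt, h0] using hc
        exact (h4.comp h3).mono_left nhdsWithin_le_nhds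
      rw [ContinuousWithinAt, hz]
      refine tendsto_of_tendsto_of_tendsto_of_le_of_le' tendsto_const_nhds h2 ?_ ?_
      · filter_upwards [self_mem_nhdsWithin] with v hv
        exact (hnonneg v hv).trans (hlow v hv)
      · filter_upwards [self_mem_nhdsWithin] with v hv using hup v hv
    -- Away from zero, substitution turns the mean into `v⁻¹` times a difference of values of a
    -- continuous primitive.
    · have hp : Continuous fun x : ℝ => ∫ s in (0 : ℝ)..x, g s :=
        intervalIntegral.continuous_primitive (fun a b => hg.intervalIntegrable) 0
      have hq : ContinuousAt (fun v : ℝ =>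
          v⁻¹ * ((∫ s in (0 : ℝ)..(v * 2), g s) - ∫ s in (0 : ℝ)..(v * 1), g s)) v := by
        refine (continuousAt_inv₀ hv.ne').mul (Continuous.continuousAt ?_)
        exact (hp.comp (by fun_prop)).sub (hp.comp (by fun_prop))
      refine (hq.congr ?_).continuousWithinAt
      filter_upwards [lt_mem_nhds hv] with x hx
      rw [intervalIntegral.integral_interval_sub_left hg.intervalIntegrable
        hg.intervalIntegrable, intervalIntegral.integral_comp_mul_left g hx.ne', smul_eq_mul]
  · intro a ha b _ hab
    exact add_lt_add_of_le_of_lt (hmono a b ha hab.le) hab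
  · simp [h0]
  · refine tendsto_atTop_mono' atTop ?_ tendsto_id
    filter_upwards [eventually_ge_atTop 0] with v hv
    simpa using (hnonneg v hv).trans (hlow v hv)
  · linarith [hlow v hv]

theorem ClassKInf.mono {γ : ℝ → ℝ} (hγ : ClassKInf γ) {a b : ℝ} (ha : 0 ≤ a) (hab : a ≤ b) :
    γ a ≤ γ b :=
  hγ.strictMonoOn.monotoneOn ha (ha.trans hab) hab

theorem ClassKInf.nonneg {γ : ℝ → ℝ} (hγ : ClassKInf γ) {a : ℝ} (ha : 0 ≤ a) : 0 ≤ γ a :=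
  hγ.map_zero ▸ hγ.mono le_rfl ha

theorem ClassKL.mono {β : ℝ → ℝ → ℝ} (hβ : ClassKL β) {a b t : ℝ} (ht : 0 ≤ t) (ha : 0 ≤ a)
    (hab : a ≤ b) : β a t ≤ β b t :=
  (hβ.strictMonoOn t ht).monotoneOn ha (ha.trans hab) hab

theorem ClassKL.nonneg {β : ℝ → ℝ → ℝ} (hβ : ClassKL β) {a t : ℝ} (ht : 0 ≤ t) (ha : 0 ≤ a) :
    0 ≤ β a t := by
  simpa [hβ.map_zero t ht] using hβ.mono ht le_rfl ha

/-- The gain obtained by balancing the decay of `β` against the loss of memory of `w`. -/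
theorem exists_fading_gain {β : ℝ → ℝ → ℝ} {γ w : ℝ → ℝ} (hβ : ClassKL β) (hγ : ClassKInf γ)
    (hw : IsDecayWeight w) {K : ℝ} (hK : 0 ≤ K) :
    ∃ γ' : ℝ → ℝ, ClassKInf γ' ∧ ∀ v, 0 ≤ v → ∀ a,
      (∀ T, 0 ≤ T → a ≤ β K T + γ (v / w T)) → a ≤ γ' v := by
  -- The majorant will be built from `⨅ T, b v T`. Truncating `v` at zero makes this monotone on all
  -- of `ℝ`.
  let b : ℝ → Ici (0 : ℝ) → ℝ := fun v T => β K T + γ (max v 0 / w T)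
  have harg : ∀ v (T : Ici (0 : ℝ)), 0 ≤ max v 0 / w T := fun v T =>
    div_nonneg (le_max_right _ _) (hw.pos T T.2).le
  have hb : ∀ v T, 0 ≤ b v T := fun v T =>
    add_nonneg (hβ.nonneg T.2 hK) (hγ.nonneg (harg v T))
  have hbdd : ∀ v, BddBelow (range (b v)) := fun v => ⟨0, by rintro _ ⟨T, rfl⟩; exact hb v T⟩
  have hmono : Monotone fun v => ⨅ T, b v T := by
    intro v v' hv
    refine ciInf_mono (hbdd v) fun T => ?_
    have := (hw.pos T T.2).le
    exact add_le_add le_rfl (hγ.mono (harg v T) (by gcongr))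
  have hnonneg : ∀ v, 0 ≤ ⨅ T, b v T := fun v => Real.iInf_nonneg (hb v)
  -- Order of choice: `T` makes `β K T` small, and only then is `v` made small relative to the fixed
  -- `w T > 0`.
  have hsmall : ∀ ε : ℝ, 0 < ε → ∀ᶠ v in 𝓝 (0 : ℝ), ⨅ T, b v T < ε := by
    intro ε hε
    obtain ⟨T, hTε, hT⟩ := (((hβ.tendsto_zero K hK).eventually_lt_const hε).and
      (eventually_ge_atTop 0)).exists
    have h1 : Tendsto (fun v : ℝ => max v 0 / w T) (𝓝 0) (𝓝[Ici 0] 0) := by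
      refine tendsto_nhdsWithin_iff.2 ⟨?_, Eventually.of_forall fun v => harg v ⟨T, hT⟩⟩
      have : Continuous fun v : ℝ => max v 0 / w T := by fun_prop
      simpa using this.tendsto 0
    have h2 : Tendsto γ (𝓝[Ici 0] 0) (𝓝 0) := by
      simpa [ContinuousWithinAt, hγ.map_zero] using hγ.continuousOn 0 self_mem_Ici
    have h3 := (h2.comp h1).const_add (β K T)
    rw [add_zero] at h3
    filter_upwards [h3.eventually_lt_const hTε] with v hv
    exact (ciInf_le (hbdd v) ⟨T, hT⟩).trans_lt hv
  have hzero : ⨅ T, b 0 T = 0 :=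
    le_antisymm (le_of_forall_pos_lt_add fun ε hε => by
      simpa using (hsmall ε hε).self_of_nhds) (hnonneg 0)
  have hcont : ContinuousAt (fun v => ⨅ T, b v T) 0 := by
    rw [ContinuousAt, hzero]
    exact tendsto_order.2 ⟨fun a ha => Eventually.of_forall fun v => ha.trans_le (hnonneg v),
      hsmall⟩
  obtain ⟨γ', hγ', hle⟩ := exists_classKInf_ge hmono hzero hcont
  refine ⟨γ', hγ', fun v hv a ha => le_trans (le_ciInf fun T => ?_) (hle v hv)⟩
  simpa [b, max_eq_left hv] using ha T T.2

/-! ### Solutions on compact intervals -/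

/-- `x` is a Carathéodory solution of `ẋ(t) = f(t, x(t))` on the compact interval `[τ, T]`. -/
def IsSolOn {X : Type*} [NormedAddCommGroup X] [NormedSpace ℝ X]
    (f : ℝ → X → X) (τ T : ℝ) (x : ℝ → X) : Prop :=
  ∀ t ∈ Icc τ T, IntervalIntegrable (fun s => f s (x s)) volume τ t ∧
    x t = x τ + ∫ s in τ..t, f s (x s)

section
variable {X U : Type*} [NormedAddCommGroup X] [NormedSpace ℝ X] [NormedAddCommGroup U]

theorem IsCaratheodorySol.isSolOn {f : ℝ → X → X} {τ T : ℝ} {ω : EReal} {x : ℝ → X}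
    (h : IsCaratheodorySol f τ ω x) (hT : (T : EReal) < ω) : IsSolOn f τ T x :=
  fun t ht => h t ht.1 ((EReal.coe_le_coe_iff.2 ht.2).trans_lt hT)

theorem IsSolOn.shift {f : ℝ → X → X} {τ σ T : ℝ} {x : ℝ → X}
    (h : IsSolOn f τ T x) (hσ : σ ∈ Icc τ T) : IsSolOn f σ T x := by
  intro t ht
  obtain ⟨h1, h2⟩ := h σ hσ
  obtain ⟨h3, h4⟩ := h t ⟨hσ.1.trans ht.1, ht.2⟩
  refine ⟨h1.symm.trans h3, ?_⟩
  rw [h4, h2, add_assoc, intervalIntegral.integral_add_adjacent_intervals h1 (h1.symm.trans h3)]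

theorem IsSolOn.mono {f : ℝ → X → X} {τ T T' : ℝ} {x : ℝ → X}
    (h : IsSolOn f τ T x) (hT : T' ≤ T) : IsSolOn f τ T' x :=
  fun t ht => h t ⟨ht.1, ht.2.trans hT⟩

theorem IsSolOn.continuousOn {f : ℝ → X → X} {τ T : ℝ} {x : ℝ → X}
    (h : IsSolOn f τ T x) : ContinuousOn x (Icc τ T) := by
  rcases lt_or_ge T τ with hT | hT
  · simp [Icc_eq_empty hT.not_ge]
  have hi := (h T ⟨hT, le_rfl⟩).1
  have hc : ContinuousOn (fun t => x τ + ∫ s in τ..t, f s (x s)) (Icc τ T) := by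
    rw [← uIcc_of_le hT]
    refine continuousOn_const.add (intervalIntegral.continuousOn_primitive_interval ?_)
    exact (intervalIntegrable_iff' (by simp)).1 hi
  exact hc.congr fun t ht => (h t ht).2

theorem IsInput.indicator {τ T : ℝ} {u : ℝ → U} (hu : ContinuousOn u (Icc τ T)) (σ : ℝ) :
    IsInput σ ((Icc τ T).indicator u) := by
  constructor
  · exact ((aestronglyMeasurable_indicator_iff measurableSet_Icc).2
      (hu.aestronglyMeasurable_of_isCompact isCompact_Icc measurableSet_Icc)).restrict
  · intro T' _
    obtain ⟨C, hC⟩ := isCompact_Icc.exists_bound_of_continuousOn hu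
    refine ⟨max C 0, Eventually.of_forall fun s => ?_⟩
    by_cases hs : s ∈ Icc τ T
    · simpa [indicator_of_mem hs] using Or.inl (hC s hs)
    · simp [indicator_of_notMem hs]

/-- The δ-ISS estimate compares global solutions only, whereas the closed loop may live on a bounded
interval. Global existence from time `T` with input zero supplies a continuation to glue on. -/
theorem DeltaISS.exists_extension {t₀ : ℝ} {f : ℝ → X → U → X} {β : ℝ → ℝ → ℝ} {γ : ℝ → ℝ}
    (hf : DeltaISS t₀ f β γ) {τ T : ℝ} (hτ : t₀ ≤ τ) (hT : τ ≤ T) {u : ℝ → U}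
    (hu : ContinuousOn u (Icc τ T)) {x : ℝ → X}
    (hx : IsSolOn (fun t x => f t x (u t)) τ T x) :
    ∃ x' : ℝ → X, EqOn x' x (Icc τ T) ∧
      IsCaratheodorySol (fun t x => f t x ((Icc τ T).indicator u t)) τ ⊤ x' := by
  obtain ⟨y, hy0, hy⟩ := hf.exists_sol T (hτ.trans hT) _ (IsInput.indicator hu T) (x T)
  let x' : ℝ → X := fun s => if s ≤ T then x s else y s
  have hx' : ∀ s, s ≤ T → x' s = x s := fun s hs => if_pos hs
  have hy' : ∀ s, T ≤ s → x' s = y s := by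
    intro s hs
    rcases hs.eq_or_lt with rfl | hs
    · rw [hx' _ le_rfl, hy0]
    · exact if_neg hs.not_ge
  have hleft : ∀ t ∈ Icc τ T, IntervalIntegrable
      (fun s => f s (x' s) ((Icc τ T).indicator u s)) volume τ t ∧
      x' t = x' τ + ∫ s in τ..t, f s (x' s) ((Icc τ T).indicator u s) := by
    intro t ht
    have heq : EqOn (fun s => f s (x s) (u s))
        (fun s => f s (x' s) ((Icc τ T).indicator u s)) (uIcc τ t) := by
      intro s hs
      rw [uIcc_of_le ht.1] at hs
      have hs' : s ∈ Icc τ T := ⟨hs.1, hs.2.trans ht.2⟩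
      simp only [hx' s hs'.2, indicator_of_mem hs']
    refine ⟨(hx t ht).1.congr (heq.mono uIoc_subset_uIcc), ?_⟩
    rw [hx' t ht.2, hx' τ hT, ← intervalIntegral.integral_congr heq]
    exact (hx t ht).2
  refine ⟨x', fun s hs => hx' s hs.2, fun t ht _ => ?_⟩
  rcases le_total t T with htT | htT
  · exact hleft t ⟨ht, htT⟩
  · obtain ⟨h1, h2⟩ := hleft T ⟨hT, le_rfl⟩
    obtain ⟨h3, h4⟩ := hy t htT (EReal.coe_lt_top t)
    have heq : EqOn (fun s => f s (y s) ((Icc τ T).indicator u s))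
        (fun s => f s (x' s) ((Icc τ T).indicator u s)) (uIcc T t) := by
      intro s hs
      rw [uIcc_of_le htT] at hs
      simp only [hy' s hs.1]
    have h5 := h3.congr (heq.mono uIoc_subset_uIcc)
    refine ⟨h1.trans h5, ?_⟩
    rw [← intervalIntegral.integral_add_adjacent_intervals h1 h5, ← add_assoc, ← h2, hy' t htT,
      hy' T le_rfl, ← intervalIntegral.integral_congr heq]
    exact h4

/-- The incremental estimate for solutions that are only given on a compact interval. -/
theorem DeltaISS.estimate_on {t₀ : ℝ} {f : ℝ → X → U → X} {β : ℝ → ℝ → ℝ} {γ : ℝ → ℝ}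
    (hf : DeltaISS t₀ f β γ) {τ T : ℝ} (hτ : t₀ ≤ τ) (hT : τ ≤ T) {u u' : ℝ → U}
    (hu : ContinuousOn u (Icc τ T)) (hu' : ContinuousOn u' (Icc τ T)) {x x' : ℝ → X}
    (hx : IsSolOn (fun t x => f t x (u t)) τ T x)
    (hx' : IsSolOn (fun t x => f t x (u' t)) τ T x') {c : ℝ} (hc : 0 ≤ c)
    (huc : ∀ s ∈ Ico τ T, ‖u s - u' s‖ ≤ c) :
    ‖x T - x' T‖ ≤ β ‖x τ - x' τ‖ (T - τ) + γ c := by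
  obtain ⟨y, hyx, hy⟩ := hf.exists_extension hτ hT hu hx
  obtain ⟨y', hyx', hy'⟩ := hf.exists_extension hτ hT hu' hx'
  have hle : ∀ a ∈ (fun s => ‖(Icc τ T).indicator u s - (Icc τ T).indicator u' s‖) '' Ico τ T,
      a ≤ c := by
    rintro _ ⟨s, hs, rfl⟩
    simpa only [indicator_of_mem (Ico_subset_Icc_self hs)] using huc s hs
  have h := hf.estimate τ hτ _ _ (IsInput.indicator hu τ) (IsInput.indicator hu' τ) y y' hy hy'
    T hT ⟨c, hle⟩
  rw [hyx ⟨hT, le_rfl⟩, hyx' ⟨hT, le_rfl⟩, hyx ⟨le_rfl, hT⟩, hyx' ⟨le_rfl, hT⟩] at h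
  -- For `T = τ` the supremum is over the empty set, hence zero; this case needs `0 ≤ c`.
  refine h.trans (add_le_add le_rfl (hf.classKInf.mono ?_ (Real.sSup_le hle hc)))
  exact Real.sSup_nonneg (by rintro _ ⟨s, _, rfl⟩; exact norm_nonneg _)

/-- Incremental input-to-state stability with fading memory of the input: among solutions with
bounded initial difference and bounded input difference, past inputs can be discounted by `w`. -/
theorem DeltaISS.exists_fading_estimate {t₀ : ℝ} {f : ℝ → X → U → X} {β : ℝ → ℝ → ℝ} {γ : ℝ → ℝ}
    (hf : DeltaISS t₀ f β γ) {w : ℝ → ℝ} (hw : IsDecayWeight w) {M R : ℝ} (hM : 0 ≤ M)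
    (hR : 0 ≤ R) :
    ∃ γ' : ℝ → ℝ, ClassKInf γ' ∧ ∀ (T : ℝ) (u u' : ℝ → U) (x x' : ℝ → X) (ρ : ℝ → ℝ), t₀ ≤ T →
      ContinuousOn u (Icc t₀ T) → ContinuousOn u' (Icc t₀ T) →
      IsSolOn (fun t x => f t x (u t)) t₀ T x → IsSolOn (fun t x => f t x (u' t)) t₀ T x' →
      ‖x t₀ - x' t₀‖ ≤ M → (∀ s ∈ Ico t₀ T, ‖u s - u' s‖ ≤ ρ s) → (∀ s ∈ Ico t₀ T, ρ s ≤ R) →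
      ‖x T - x' T‖ ≤ β ‖x t₀ - x' t₀‖ (T - t₀) +
        γ' (sSup ((fun s => ρ s * w (T - s)) '' Ico t₀ T)) := by
  have hβ := hf.classKL
  have hγ := hf.classKInf
  -- This constant bounds the difference of the solutions at every restart time `T - L`, uniformly
  -- in the solutions.
  have hK : 0 ≤ β M 0 + γ R := add_nonneg (hβ.nonneg le_rfl hM) (hγ.nonneg hR)
  obtain ⟨γ', hγ', h⟩ := exists_fading_gain hβ hγ hw hK
  refine ⟨γ', hγ', fun T u u' x x' ρ hT hu hu' hx hx' hxM huρ hρR => ?_⟩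
  have hρ : ∀ s ∈ Ico t₀ T, 0 ≤ ρ s := fun s hs => (norm_nonneg _).trans (huρ s hs)
  set v := sSup ((fun s => ρ s * w (T - s)) '' Ico t₀ T) with hv
  have hbdd : BddAbove ((fun s => ρ s * w (T - s)) '' Ico t₀ T) := by
    refine ⟨R, ?_⟩
    rintro _ ⟨s, hs, rfl⟩
    have h0 : 0 ≤ T - s := sub_nonneg.2 hs.2.le
    exact (mul_le_of_le_one_right (hρ s hs) (hw.le_one _ h0)).trans (hρR s hs)
  have hv0 : 0 ≤ v := by
    refine Real.sSup_nonneg ?_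
    rintro _ ⟨s, hs, rfl⟩
    exact mul_nonneg (hρ s hs) (hw.pos _ (sub_nonneg.2 hs.2.le)).le
  have hρv : ∀ L, 0 ≤ L → ∀ s ∈ Ico t₀ T, T - L ≤ s → ρ s ≤ v / w L := by
    intro L hL s hs hLs
    have h0 : 0 ≤ T - s := sub_nonneg.2 hs.2.le
    rw [le_div_iff₀ (hw.pos L hL)]
    refine le_trans ?_ (le_csSup hbdd ⟨s, hs, rfl⟩)
    exact mul_le_mul_of_nonneg_left (hw.antitoneOn h0 hL (by linarith)) (hρ s hs)
  -- The initial term is subtracted so that the gain need only dominate a quantity bounded for every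
  -- memory length `L`.
  suffices ∀ L, 0 ≤ L → ‖x T - x' T‖ - β ‖x t₀ - x' t₀‖ (T - t₀) ≤
      β (β M 0 + γ R) L + γ (v / w L) by
    linarith [h v hv0 _ this]
  intro L hL
  have hvL : 0 ≤ v / w L := div_nonneg hv0 (hw.pos L hL).le
  -- If the memory window covers all of `[t₀, T)`, no restart is needed. Otherwise the estimate is
  -- applied up to `T - L` with the crude bound `R`, then again from there, and the initial term is
  -- merely nonnegative slack.
  rcases le_total (T - t₀) L with hTL | hTL
  · have h1 := hf.estimate_on le_rfl hT hu hu' hx hx' hvL fun s hs =>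
      (huρ s hs).trans (hρv L hL s hs (by linarith [hs.1]))
    linarith [hβ.nonneg hL hK]
  · have hσ : T - L ∈ Icc t₀ T := ⟨by linarith, by linarith⟩
    have hsub : Icc (T - L) T ⊆ Icc t₀ T := Icc_subset_Icc_left hσ.1
    have hsub' : Icc t₀ (T - L) ⊆ Icc t₀ T := Icc_subset_Icc_right hσ.2
    have h1 := hf.estimate_on hσ.1 hσ.2 (hu.mono hsub) (hu'.mono hsub) (hx.shift hσ)
      (hx'.shift hσ) hvL fun s hs =>
        (huρ s ⟨hσ.1.trans hs.1, hs.2⟩).trans (hρv L hL s ⟨hσ.1.trans hs.1, hs.2⟩ hs.1)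
    have h2 := hf.estimate_on le_rfl hσ.1 (hu.mono hsub') (hu'.mono hsub') (hx.mono hσ.2)
      (hx'.mono hσ.2) hR fun s hs =>
        (huρ s ⟨hs.1, hs.2.trans_le hσ.2⟩).trans (hρR s ⟨hs.1, hs.2.trans_le hσ.2⟩)
    have h3 : β ‖x t₀ - x' t₀‖ (T - L - t₀) ≤ β M 0 :=
      (hβ.antitoneOn _ (norm_nonneg _) self_mem_Ici (mem_Ici.2 (by linarith))
        (by linarith)).trans (hβ.mono le_rfl (norm_nonneg _) hxM)
    have h4 : β ‖x (T - L) - x' (T - L)‖ (T - (T - L)) ≤ β (β M 0 + γ R) L := by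
      rw [sub_sub_cancel]
      exact hβ.mono hL (norm_nonneg _) (by linarith)
    linarith [hβ.nonneg (sub_nonneg.2 hT) (norm_nonneg (x t₀ - x' t₀))]

/-- Bounded linear maps commute with the integral. The vector fields need to be related only along
the given trajectory, which is what allows `g` to contain inputs built from it. -/
theorem IsSolOn.map {Y : Type*} [NormedAddCommGroup Y] [NormedSpace ℝ Y] [CompleteSpace X]
    [CompleteSpace Y] (L : X →L[ℝ] Y) {f : ℝ → X → X} {g : ℝ → Y → Y} {τ T : ℝ} {x : ℝ → X}
    (h : IsSolOn f τ T x) (hg : ∀ t ∈ Icc τ T, L (f t (x t)) = g t (L (x t))) :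
    IsSolOn g τ T (fun t => L (x t)) := by
  intro t ht
  obtain ⟨h1, h2⟩ := h t ht
  have heq : EqOn (fun s => L (f s (x s))) (fun s => g s (L (x s))) (uIcc τ t) := by
    intro s hs
    rw [uIcc_of_le ht.1] at hs
    exact hg s ⟨hs.1, hs.2.trans ht.2⟩
  have h3 : IntervalIntegrable (fun s => L (f s (x s))) volume τ t :=
    ⟨L.integrable_comp h1.1, L.integrable_comp h1.2⟩
  refine ⟨h3.congr (heq.mono uIoc_subset_uIcc), ?_⟩
  dsimp only
  rw [← intervalIntegral.integral_congr heq, L.intervalIntegral_comp_comm h1, ← map_add, ← h2]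

end

/-! ### The multi-agent system -/

theorem norm_sub_average_le {E : Type*} [NormedAddCommGroup E] [NormedSpace ℝ E] {N : ℕ}
    (hN : N ≠ 0) (v : Fin N → E) (a : E) {r : ℝ} (h : ∀ j, ‖a - v j‖ ≤ r) :
    ‖a - (1 / (N : ℝ)) • ∑ j, v j‖ ≤ r := by
  have hN' : (N : ℝ) ≠ 0 := Nat.cast_ne_zero.2 hN
  have heq : a - (1 / (N : ℝ)) • ∑ j, v j = (1 / (N : ℝ)) • ∑ j, (a - v j) := by
    rw [Finset.sum_sub_distrib, smul_sub, Finset.sum_const, Finset.card_univ, Fintype.card_fin,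
      ← Nat.cast_smul_eq_nsmul ℝ, smul_smul, one_div_mul_cancel hN', one_smul]
  have hsum : ‖∑ j, (a - v j)‖ ≤ N * r := by
    simpa using norm_sum_le_of_le (Finset.univ : Finset (Fin N)) fun j _ => h j
  rw [heq, norm_smul, Real.norm_of_nonneg (by positivity), one_div, inv_mul_le_iff₀ (by positivity)]
  exact hsum

namespace AgentNetwork

variable {N m n : ℕ} {S : AgentNetwork N m n}

theorem Psi_nonneg (h : S.DesignFunctions) {t : ℝ} (ht : S.t₀ ≤ t) : 0 ≤ S.Psi t :=
  Real.iSup_nonneg fun q => (h.ψ_pos _ _ q.2 _ t ht).le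

theorem le_Psi {i j : Fin N} (hij : S.G.Adj i j) (p : Fin m) (t : ℝ) : S.ψ i j p t ≤ S.Psi t :=
  le_ciSup (f := fun q : {q : Fin N × Fin N × Fin m // S.G.Adj q.1 q.2.1} =>
    S.ψ q.1.1 q.1.2.1 q.1.2.2 t) (Set.finite_range _).bddAbove ⟨(i, j, p), hij⟩

theorem exists_funnelRadius_le (h : S.DesignFunctions) :
    ∃ R : ℝ, 0 ≤ R ∧ ∀ t, S.t₀ ≤ t → S.funnelRadius t ≤ R := by
  have h1 : ∀ q : {q : Fin N × Fin N × Fin m // S.G.Adj q.1 q.2.1}, ∃ C : ℝ, ∀ t, S.t₀ ≤ t →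
      S.ψ q.1.1 q.1.2.1 q.1.2.2 t ≤ C := fun q => h.ψ_bounded _ _ q.2 _
  choose C hC using h1
  have hC0 : 0 ≤ ⨆ q, C q := Real.iSup_nonneg fun q =>
    (h.ψ_pos _ _ q.2 _ S.t₀ le_rfl).le.trans (hC q S.t₀ le_rfl)
  refine ⟨S.G.diam * ⨆ q, C q, by positivity, fun t ht => ?_⟩
  refine mul_le_mul_of_nonneg_left (Real.iSup_le (fun q => ?_) hC0) (Nat.cast_nonneg _)
  exact (hC q t ht).trans (le_ciSup (Set.finite_range C).bddAbove q)

/-- Within the domain of the coupling, the outputs differ by at most `d_G Ψ(t)`. -/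
theorem norm_output_sub_le (hG : S.G.Connected) (h : S.DesignFunctions) {t : ℝ} (ht : S.t₀ ≤ t)
    {y : Fin N → Fin m → ℝ}
    (hy : ∀ i j, S.G.Adj i j → ∀ p, |y j p - y i p| < S.ψ i j p t) (i j : Fin N) :
    ‖y j - y i‖ ≤ S.funnelRadius t := by
  have hwalk : ∀ (a b : Fin N) (W : S.G.Walk a b), ‖y b - y a‖ ≤ W.length * S.Psi t := by
    intro a b W
    induction W with
    | nil => simp
    | @cons a c b hac W ih =>
      have h1 : ‖y c - y a‖ ≤ S.Psi t :=
        (pi_norm_le_iff_of_nonneg (Psi_nonneg h ht)).2 fun p => by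
          simpa using (hy a c hac p).le.trans (le_Psi hac p t)
      have h2 := norm_add_le (y b - y c) (y c - y a)
      rw [sub_add_sub_cancel] at h2
      rw [SimpleGraph.Walk.length_cons]
      push_cast
      linarith
  obtain ⟨W, hW⟩ := hG.exists_walk_length_eq_dist i j
  have : Nonempty (Fin N) := hG.nonempty
  refine (hwalk i j W).trans (mul_le_mul_of_nonneg_right ?_ (Psi_nonneg h ht))
  rw [hW]
  -- Connectedness of the finite graph makes the diameter finite, so its natural-number value is not
  -- the default zero.
  exact_mod_cast SimpleGraph.dist_le_diam (SimpleGraph.connected_iff_ediam_ne_top.1 hG)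

open Classical in
/-- Over an undirected graph, the coupling terms cancel in the average. -/
theorem sum_gain_mul_coupling (hΓ : S.GainMatrix) (h : S.DesignFunctions) {t : ℝ}
    (ht : S.t₀ ≤ t) (w : (i : Fin N) → Fin (S.k i) → ℝ) {y : Fin N → Fin m → ℝ}
    (hy : ∀ i j, S.G.Adj i j → ∀ p, |y j p - y i p| < S.ψ i j p t) :
    ∑ i, S.Γ i t (w i) *ᵥ S.coupling i t (w i) y = 0 := by
  have h1 : ∀ i, S.Γ i t (w i) *ᵥ S.coupling i t (w i) y =
      ∑ j with S.G.Adj i j, (fun p => S.μ i j p ((y j p - y i p) / S.ψ i j p t)) := by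
    intro i
    rw [coupling, Matrix.mulVec_mulVec, Matrix.mul_nonsing_inv _
      ((Matrix.isUnit_iff_isUnit_det _).1 (hΓ.isUnit i t ht (w i))), Matrix.one_mulVec]
  ext p
  simp only [h1, Finset.sum_apply, Pi.zero_apply]
  simp only [Finset.sum_filter]
  set A := fun i j : Fin N =>
    if S.G.Adj i j then S.μ i j p ((y j p - y i p) / S.ψ i j p t) else 0 with hA
  have hanti : ∀ i j, A i j = -A j i := by
    intro i j
    by_cases hij : S.G.Adj i j
    · have hpos := h.ψ_pos i j hij p t ht
      -- The symmetry of `μ` is available only on `(-1, 1)`, so membership in the coupling domain is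
      -- essential.
      have hs : (y i p - y j p) / S.ψ i j p t ∈ Ioo (-1 : ℝ) 1 := by
        have h2 := hy j i hij.symm p
        rw [h.ψ_symm j i hij.symm p t ht, abs_lt] at h2
        exact ⟨by rw [lt_div_iff₀ hpos]; linarith, by rw [div_lt_one hpos]; exact h2.2⟩
      have h3 := h.μ_symm i j hij p _ hs
      rw [← neg_div, neg_sub] at h3
      simp only [hA, if_pos hij, if_pos hij.symm, h3, h.ψ_symm j i hij.symm p t ht]
    · have hji : ¬ S.G.Adj j i := fun hji => hij hji.symm
      simp [hA, if_neg hij, if_neg hji]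
  -- Exchanging the two summations of an antisymmetric array shows that the total equals its own
  -- negative.
  have h4 : ∑ i, ∑ j, A i j = -∑ i, ∑ j, A i j := by
    conv_lhs => rw [Finset.sum_comm]
    simp only [← Finset.sum_neg_distrib, ← hanti]
  change ∑ i, ∑ j, A i j = 0
  linarith

section
variable {ω : EReal} {y : ℝ → Fin N → Fin m → ℝ} {z : ℝ → Fin N → Fin n → ℝ} {T : ℝ}

theorem IsClosedLoopSol.isSolOn_internal (h : S.IsClosedLoopSol ω y z) (hT : (T : EReal) < ω)
    (i : Fin N) : IsSolOn (fun t x => S.Z t x (y t i)) S.t₀ T (fun t => z t i) :=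
  (h.sol.isSolOn hT).map ((ContinuousLinearMap.proj (R := ℝ) i).comp
    (ContinuousLinearMap.snd ℝ (Fin N → Fin m → ℝ) (Fin N → Fin n → ℝ))) fun _ _ => rfl

theorem IsClosedLoopSol.continuousOn_output (h : S.IsClosedLoopSol ω y z) (hT : (T : EReal) < ω)
    (i : Fin N) : ContinuousOn (fun t => y t i) (Icc S.t₀ T) :=
  (continuous_apply i).comp_continuousOn
    (continuous_fst.comp_continuousOn (h.sol.isSolOn hT).continuousOn)

theorem IsClosedLoopSol.continuousOn_internal (h : S.IsClosedLoopSol ω y z)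
    (hT : (T : EReal) < ω) (i : Fin N) : ContinuousOn (fun t => z t i) (Icc S.t₀ T) :=
  (continuous_apply i).comp_continuousOn
    (continuous_snd.comp_continuousOn (h.sol.isSolOn hT).continuousOn)

/-- The deviations that drive the perturbed reduced order blended dynamics. -/
noncomputable def deviation (y : Fin N → Fin m → ℝ) (z : Fin N → Fin n → ℝ) (i : Fin N) :
    (Fin m → ℝ) × (Fin N → Fin m → ℝ) × (Fin N → Fin n → ℝ) :=
  (y i - (1 / (N : ℝ)) • ∑ j, y j, fun j => y j - (1 / (N : ℝ)) • ∑ k, y k, fun j => z j - z i)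

/-- The average output and the internal state of any agent solve the perturbed reduced order
blended dynamics. -/
theorem IsClosedLoopSol.isSolOn_perturbedReduced (h : S.IsClosedLoopSol ω y z)
    (hΓ : S.GainMatrix) (hd : S.DesignFunctions) (hT : (T : EReal) < ω) (i : Fin N) :
    IsSolOn (fun t x => S.perturbedReduced t x (deviation (y t) (z t) i)) S.t₀ T
      (fun t => ((1 / (N : ℝ)) • ∑ j, y t j, z t i)) := by
  let A : (Fin N → Fin m → ℝ) →L[ℝ] (Fin m → ℝ) :=
    (1 / (N : ℝ)) • ∑ j, ContinuousLinearMap.proj j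
  have hA : ∀ v, A v = (1 / (N : ℝ)) • ∑ j, v j := fun v => by
    simp [A]
  let L := A.prodMap (ContinuousLinearMap.proj (R := ℝ) (φ := fun _ : Fin N => Fin n → ℝ) i)
  have hL : ∀ v, L v = ((1 / (N : ℝ)) • ∑ j, v.1 j, v.2 i) := fun v => by
    rw [← hA]; rfl
  have h1 := (h.sol.isSolOn hT).map
    (g := fun t x => S.perturbedReduced t x (deviation (y t) (z t) i)) L (fun t ht => ?_)
  · simpa only [hL] using h1
  · have hsum := sum_gain_mul_coupling hΓ hd ht.1 (fun i => S.W i (y t i) (z t i))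
      (h.mem_domain t ht.1 ((EReal.coe_le_coe_iff.2 ht.2).trans_lt hT))
    -- Adding the deviations to the average output and to `z i` restores the true `y j` and `z j`,
    -- so both fields are evaluated at the same points.
    simp [closedLoop, perturbedReduced, deviation, hL, Finset.sum_add_distrib, hsum]

theorem continuousOn_deviation (h : S.IsClosedLoopSol ω y z) (hT : (T : EReal) < ω)
    (i : Fin N) : ContinuousOn (fun t => deviation (y t) (z t) i) (Icc S.t₀ T) := by
  have hy := h.continuousOn_output hT
  have hz := h.continuousOn_internal hT
  have havg : ContinuousOn (fun t => (1 / (N : ℝ)) • ∑ j, y t j) (Icc S.t₀ T) :=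
    ContinuousOn.fun_const_smul (continuousOn_finsetSum _ fun j _ => hy j) _
  exact ((hy i).sub havg).prodMk ((continuousOn_pi.2 fun j => (hy j).sub havg).prodMk
    (continuousOn_pi.2 fun j => (hz j).sub (hz i)))

end

/-- The gain in (b) is chosen before the solution, so `D` must be bounded uniformly over all initial
internal states of spread at most `M`. -/
theorem exists_D_le (hd : S.DesignFunctions) {βt : ℝ → ℝ → ℝ} {γt wt : ℝ → ℝ} (hβ : ClassKL βt)
    (hγ : ClassKInf γt) (hw : IsDecayWeight wt) {M : ℝ} (hM : 0 ≤ M) :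
    ∃ R : ℝ, ∀ z₀ : Fin N → Fin n → ℝ, (∀ i j, ‖z₀ j - z₀ i‖ ≤ M) → ∀ t, S.t₀ ≤ t →
      S.D βt γt wt z₀ t ≤ R := by
  obtain ⟨R, hR, hle⟩ := exists_funnelRadius_le hd
  refine ⟨βt M 0 + γt R, fun z₀ hz t ht => add_le_add ?_ (hγ.mono ?_ ?_)⟩
  · refine Real.iSup_le (fun q => ?_) (hβ.nonneg le_rfl hM)
    have ht' : 0 ≤ t - S.t₀ := sub_nonneg.2 ht
    exact (hβ.antitoneOn _ (norm_nonneg _) self_mem_Ici ht' ht').trans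
      (hβ.mono le_rfl (norm_nonneg _) (hz _ _))
  · refine Real.sSup_nonneg ?_
    rintro _ ⟨s, hs, rfl⟩
    exact mul_nonneg (mul_nonneg (Nat.cast_nonneg _) (Psi_nonneg hd hs.1))
      (hw.pos _ (sub_nonneg.2 hs.2.le)).le
  · refine Real.sSup_le ?_ hR
    rintro _ ⟨s, hs, rfl⟩
    exact (mul_le_of_le_one_right (mul_nonneg (Nat.cast_nonneg _) (Psi_nonneg hd hs.1))
      (hw.le_one _ (sub_nonneg.2 hs.2.le))).trans (hle s hs.1)

/-- Differences of internal states fade along with the funnel. -/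
theorem exists_DBoundsInternal (hG : S.G.Connected) (hd : S.DesignFunctions)
    {βt : ℝ → ℝ → ℝ} {γb : ℝ → ℝ} (hZ : DeltaISS S.t₀ S.Z βt γb) {M : ℝ} (hM : 0 ≤ M)
    {wt : ℝ → ℝ} (hwt : IsDecayWeight wt) :
    ∃ γt : ℝ → ℝ, ClassKInf γt ∧ S.DBoundsInternal M βt γt wt := by
  obtain ⟨R, hR, hle⟩ := exists_funnelRadius_le hd
  obtain ⟨γt, hγt, h⟩ := hZ.exists_fading_estimate hwt hM hR
  refine ⟨γt, hγt, fun ω y z hsol hz t ht htω i j => ?_⟩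
  refine (h t (fun s => y s j) (fun s => y s i) (fun s => z s j) (fun s => z s i)
    S.funnelRadius ht (hsol.continuousOn_output htω j) (hsol.continuousOn_output htω i)
    (hsol.isSolOn_internal htω j) (hsol.isSolOn_internal htω i) (hz i j) (fun s hs => ?_)
    (fun s hs => hle s hs.1)).trans (add_le_add ?_ le_rfl)
  · exact norm_output_sub_le hG hd hs.1
      (hsol.mem_domain s hs.1 ((EReal.coe_lt_coe_iff.2 hs.2).trans htω)) i j
  · exact le_ciSup (f := fun q : Fin N × Fin N =>
      βt ‖z S.t₀ q.2 - z S.t₀ q.1‖ (t - S.t₀)) (Set.finite_range _).bddAbove (i, j)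

end AgentNetwork

theorem corollary3 {N m n : ℕ} (S : AgentNetwork N m n)
    (h_open : S.OpenLoop) (h_gain : S.GainMatrix) (h_graph : S.G.Connected)
    (h_design : S.DesignFunctions) (h_escape : S.NoFiniteEscape)
    (βt : ℝ → ℝ → ℝ) (γb : ℝ → ℝ) (h_internal : DeltaISS S.t₀ S.Z βt γb)
    (β : ℝ → ℝ → ℝ) (γh : ℝ → ℝ) (h_reduced : DeltaISS S.t₀ S.perturbedReduced β γh)
    (M : ℝ) (hM : 0 < M) (wt : ℝ → ℝ) (hwt : IsDecayWeight wt) :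
    (∃ γt : ℝ → ℝ, ClassKInf γt ∧ S.DBoundsInternal M βt γt wt) ∧
    ∀ γt : ℝ → ℝ, ClassKInf γt → S.DBoundsInternal M βt γt wt →
      ∀ w : ℝ → ℝ, IsDecayWeight w →
        ∃ γ : ℝ → ℝ, ClassKInf γ ∧
          ∀ (ω : EReal) (y : ℝ → Fin N → Fin m → ℝ) (z : ℝ → Fin N → Fin n → ℝ),
            S.IsClosedLoopSol ω y z → (∀ i j, ‖z S.t₀ j - z S.t₀ i‖ ≤ M) →
            ∀ (s' : ℝ → Fin m → ℝ) (z' : ℝ → Fin n → ℝ),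
              IsCaratheodorySol S.reducedBlended S.t₀ ⊤ (fun t => (s' t, z' t)) →
              s' S.t₀ = (1 / (N : ℝ)) • ∑ i, y S.t₀ i →
              z' S.t₀ = (1 / (N : ℝ)) • ∑ i, z S.t₀ i →
              ∀ (i : Fin N) (t : ℝ), S.t₀ ≤ t → (t : EReal) < ω →
                ‖(y t i - s' t, z t i - z' t)‖ ≤
                  β ‖z S.t₀ i - z' S.t₀‖ (t - S.t₀) +
                  γ (sSup ((fun s => max (S.funnelRadius s) (S.D βt γt wt (z S.t₀) s) *
                    w (t - s)) '' Ico S.t₀ t)) +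
                  S.funnelRadius t := by
  refine ⟨AgentNetwork.exists_DBoundsInternal h_graph h_design h_internal hM.le hwt,
    fun γt hγt hD w hw => ?_⟩
  have hN : N ≠ 0 := by
    rintro rfl
    exact h_graph.nonempty.elim Fin.elim0
  obtain ⟨R₁, hR₁, hle₁⟩ := AgentNetwork.exists_funnelRadius_le h_design
  obtain ⟨R₂, hle₂⟩ :=
    AgentNetwork.exists_D_le (n := n) h_design h_internal.classKL hγt hwt hM.le
  obtain ⟨γ, hγ, hest⟩ :=
    h_reduced.exists_fading_estimate hw hM.le (hR₁.trans (le_max_left R₁ R₂))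
  refine ⟨γ, hγ, fun ω y z hsol hz s' z' hred hs0 hz0 i t ht htω => ?_⟩
  have hlt : ∀ s ∈ Ico S.t₀ t, (s : EReal) < ω := fun s hs =>
    (EReal.coe_lt_coe_iff.2 hs.2).trans htω
  have hfun : ∀ s, S.t₀ ≤ s → (s : EReal) < ω → ∀ i j, ‖y s j - y s i‖ ≤ S.funnelRadius s :=
    fun s hs hsω =>
      AgentNetwork.norm_output_sub_le h_graph h_design hs (hsol.mem_domain s hs hsω)
  have havg : ∀ s, S.t₀ ≤ s → (s : EReal) < ω → ∀ j,
      ‖y s j - (1 / (N : ℝ)) • ∑ k, y s k‖ ≤ S.funnelRadius s := fun s hs hsω j =>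
    norm_sub_average_le hN _ _ fun k => hfun s hs hsω k j
  have hred' : IsSolOn (fun t x => S.perturbedReduced t x 0) S.t₀ t (fun t => (s' t, z' t)) := by
    have heq : (fun t x => S.perturbedReduced t x 0) = S.reducedBlended := by
      ext t x <;> simp [AgentNetwork.perturbedReduced, AgentNetwork.reducedBlended]
    rw [heq]
    exact hred.isSolOn (EReal.coe_lt_top t)
  -- Both output components start at the same average, so only the internal component enters `β`.
  have hinit : ‖((1 / (N : ℝ)) • ∑ j, y S.t₀ j, z S.t₀ i) - (s' S.t₀, z' S.t₀)‖ =
      ‖z S.t₀ i - z' S.t₀‖ := by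
    simp [hs0, Prod.norm_def]
  have hinitM : ‖z S.t₀ i - z' S.t₀‖ ≤ M := by
    rw [hz0]
    exact norm_sub_average_le hN _ _ fun k => hz k i
  have hmain := hest t (fun s => AgentNetwork.deviation (y s) (z s) i) (fun _ => 0)
    (fun s => ((1 / (N : ℝ)) • ∑ j, y s j, z s i)) (fun s => (s' s, z' s))
    (fun s => max (S.funnelRadius s) (S.D βt γt wt (z S.t₀) s)) ht
    (AgentNetwork.continuousOn_deviation hsol htω i) continuousOn_const
    (hsol.isSolOn_perturbedReduced h_gain h_design htω i) hred' (hinit.trans_le hinitM)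
    (fun s hs => ?_) (fun s hs => max_le_max (hle₁ s hs.1) (hle₂ _ hz s hs.1))
  · rw [hinit] at hmain
    -- The fading estimate controls the average output; the second summand is the distance of agent
    -- `i` from it.
    have hsplit : (y t i - s' t, z t i - z' t) =
        (((1 / (N : ℝ)) • ∑ j, y t j, z t i) - (s' t, z' t)) +
          (y t i - (1 / (N : ℝ)) • ∑ j, y t j, 0) := by
      ext <;> simp
    rw [hsplit]
    refine (norm_add_le _ _).trans (add_le_add hmain ?_)
    simpa [Prod.norm_def] using havg t ht htω i
  · have h0 : 0 ≤ max (S.funnelRadius s) (S.D βt γt wt (z S.t₀) s) :=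
      le_max_of_le_left ((norm_nonneg _).trans (havg s hs.1 (hlt s hs) i))
    rw [sub_zero]
    refine max_le ((havg s hs.1 (hlt s hs) i).trans (le_max_left _ _)) (max_le ?_ ?_)
    · exact (pi_norm_le_iff_of_nonneg h0).2 fun j =>
        (havg s hs.1 (hlt s hs) j).trans (le_max_left _ _)
    · exact (pi_norm_le_iff_of_nonneg h0).2 fun j =>
        (hD ω y z hsol hz s hs.1 (hlt s hs) i j).trans (le_max_right _ _)
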